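/- Let $q$ be a prime power with $q\equiv 1\pmod 4$. Let $$\psi_6(x)=\tfrac12\left(x+x^{q^3}\right)^{q^2}+\tfrac12\left(x-x^{q^3}\right)^{q}=\tfrac12\left(x^q+x^{q^2}-x^{q^4}+x^{q^5}\right),\qquad x\in\mathbb F_{q^6}.$$ For an $\mathbb F_q$-subspace $U$ of $\mathbb F_{q^6}^2$, let $L_U=\{\langle u\rangle_{\mathbb F_{q^6}} : u\in U\setminus\{0\}\}$ be the $\mathbb F_q$-linear set of points of $\mathrm{PG}(1,q^6)$ defined by $U$, and let $L_{\psi_6}=L_{U_{\psi_6}}$, where $U_{\psi_6}=\{(x,\psi_6(x)) : x\in\mathbb F_{q^6}\}$. Then: 1. the $\mathcal Z(\Gamma\mathrm L)$-class of $L_{\psi_6}$ is two, that is, $2$ is the greatest integer $r$ such that there exist $\mathbb F_q$-subspaces $U_1,\dots,U_r$ of $\mathbb F_{q^6}^2$ with $L_{U_i}=L_{\psi_6}$ for all $i$ and $U_i\neq\lambda U_j$ for all distinct $i,j$ and all $\lambda\in\mathbb F_{q^6}^*$; 2. $L_{\psi_6}$ is a simple linear set, that is, its $\Gamma\mathrm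 L$-class is one: $1$ is the greatest integer $s$ such that there exist $\mathbb F_q$-subspaces $U_1,\dots,U_s$ of $\mathbb F_{q^6}^2$ with $L_{U_i}=L_{\psi_6}$ for all $i$ and with $U_i$, $U_j$ not on the same $\Gamma\mathrm L(2,q^6)$-orbit for all distinct $i,j$. -/

import Mathlib

open scoped LinearAlgebra.Projectivization Pointwise

/-- The `K`-linear map `x ↦ x ^ (q ^ i)` of `L`, where `q` is the order of the finite field `K`. -/
def qPow (K L : Type*) [Field K] [Fintype K] [Field L] [Algebra K L] (i : ℕ) : L →ₗ[K] L :=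
  (FiniteField.frobeniusAlgHom K L ^ i).toLinearMap

theorem qPow_apply (K L : Type*) [Field K] [Fintype K] [Field L] [Algebra K L] (i : ℕ) (x : L) :
    qPow K L i x = x ^ (Fintype.card K ^ i) := by
  have h : ∀ y : L, (FiniteField.frobeniusAlgHom K L ^ i) y = y ^ (Fintype.card K ^ i) := by
    induction i with
    | zero => intro y; simp
    | succ i ih => intro y; rw [pow_succ, AlgHom.mul_apply, ih]; simp [← pow_mul, pow_succ']
  exact h x

/-- `α(x) = (x + x^(q^t))^(q^(t-1)) / 2`, with `x + x^(q^t)` the trace of `x` from the field of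
order `q^(2t)` to the field of order `q^t`. -/
def alphaMap (K L : Type*) [Field K] [Fintype K] [Field L] [Algebra K L] (t : ℕ) : L →ₗ[K] L :=
  (2⁻¹ : L) • (qPow K L (t - 1) ∘ₗ (LinearMap.id + qPow K L t))

/-- `β(x) = (x - x^(q^t))^q / 2`. -/
def betaMap (K L : Type*) [Field K] [Fintype K] [Field L] [Algebra K L] (t : ℕ) : L →ₗ[K] L :=
  (2⁻¹ : L) • (qPow K L 1 ∘ₗ (LinearMap.id - qPow K L t))

/-- The `q`-polynomial map `ψ_n = α_n + β_n`, with `n = 2t` the degree of `L` over `K`. -/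
def psiMap (K L : Type*) [Field K] [Fintype K] [Field L] [Algebra K L] (t : ℕ) : L →ₗ[K] L :=
  alphaMap K L t + betaMap K L t

theorem psiMap_three_apply (K L : Type*) [Field K] [Fintype K] [Field L] [Algebra K L] (x : L) :
    psiMap K L 3 x = (x ^ Fintype.card K + x ^ (Fintype.card K ^ 2)
      - x ^ (Fintype.card K ^ 4) + x ^ (Fintype.card K ^ 5)) / 2 := by
  simp only [psiMap, alphaMap, betaMap, LinearMap.add_apply, LinearMap.smul_apply,
    LinearMap.comp_apply, LinearMap.sub_apply, LinearMap.id_apply, map_add, map_sub, qPow_apply,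
    smul_eq_mul]
  ring

/-- The set `L_U` of the points `⟨u⟩` of the projective line `PG(L², L)`, `u ∈ U \ {0}`, defined
by a `K`-subspace `U` of `L²`. -/
def linearSet (K L : Type*) [Field K] [Field L] [Algebra K L] (U : Submodule K (L × L)) :
    Set (ℙ L (L × L)) :=
  {P | ∃ (u : L × L) (hu : u ≠ 0), u ∈ U ∧ P = Projectivization.mk L u hu}

/-- `U` and `W` are on the same orbit of `ΓL(2, L)`, the group of the bijective semilinear maps
of `L²`. -/
def SameGammaLOrbit (K L : Type*) [Field K] [Field L] [Algebra K L]
    (U W : Submodule K (L × L)) : Prop :=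
  ∃ (σ : L ≃+* L) (g : (L × L) ≃+ (L × L)),
    (∀ (c : L) (v : L × L), g (c • v) = σ c • g v) ∧ g '' (U : Set (L × L)) = (W : Set (L × L))

/-- The set of points `S` has `Z(ΓL)`-class `r`: `r` is the greatest integer such that there are
`K`-subspaces `U_1, …, U_r` of `L²` that define `S`, no two of which differ by a nonzero scalar
of `L`. -/
def HasZGammaLClass (K L : Type*) [Field K] [Field L] [Algebra K L] (S : Set (ℙ L (L × L)))
    (r : ℕ) : Prop :=
  IsGreatest {m : ℕ | ∃ U : Fin m → Submodule K (L × L),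
    (∀ i, linearSet K L (U i) = S) ∧
    ∀ i j, i ≠ j → ∀ c : L, c ≠ 0 → U i ≠ c • U j} r

/-- The set of points `S` has `ΓL`-class `s`: `s` is the greatest integer such that there are
`K`-subspaces `U_1, …, U_s` of `L²` that define `S`, no two of which are on the same orbit of
`ΓL(2, L)`. -/
def HasGammaLClass (K L : Type*) [Field K] [Field L] [Algebra K L] (S : Set (ℙ L (L × L)))
    (s : ℕ) : Prop :=
  IsGreatest {m : ℕ | ∃ U : Fin m → Submodule K (L × L),
    (∀ i, linearSet K L (U i) = S) ∧
    ∀ i j, i ≠ j → ¬ SameGammaLOrbit K L (U i) (U j)} s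

/-- A simple `K`-linear set is a `K`-linear set of `ΓL`-class one. -/
def IsSimpleLinearSet (K L : Type*) [Field K] [Field L] [Algebra K L]
    (S : Set (ℙ L (L × L))) : Prop :=
  (∃ U : Submodule K (L × L), linearSet K L U = S) ∧ HasGammaLClass K L S 1

/-- `U_f = {(x, f(x)) : x ∈ L}` for a `K`-linear map `f` of `L`. -/
def graphSubspace (K L : Type*) [Field K] [Field L] [Algebra K L] (f : L →ₗ[K] L) :
    Submodule K (L × L) :=
  f.graph

/-! Call `m` a slope of a `K`-linear map `f` of `L` if `f x = m * x` for some nonzero `x`; for a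
graph, the linear set is exactly the set of slopes. The nonzero solutions of `f x = m * x` number `q
^ r - 1` with `r ≥ 1`, that is `-1` in `L`, so `∑ x, (f x / x) ^ d` is minus the `d`-th power sum of
the slopes and depends only on the linear set. For `d` a sum of fewer than `q` distinct powers `q ^
i` with `i < 6`, expanding `f` as a `q`-polynomial and using uniqueness of base-`q` digits turns
this sum into minus a principal permanent of the Dickson matrix (`dicksonMatrix_permanent_eq`). It
is a permanent because no signs occur.

Since `q ≥ 5`, permanents of order up to four are available. Comparing them with those of `ψ_6`
forces the coefficients of any competing `g` to be those of `ψ_6` or of its inverse, twisted by a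
scalar `l` (`coeff_relations`, `exists_scalar_of_coeff_relations`); the scalar comes from Hilbert
90.

That every competing subspace is a graph follows from scatteredness of `ψ_6`: the vertical point is
missing, so the rank is at most six, and there are too many points for a smaller rank. Scatteredness
is where `-1` being a square in `K` enters.

Conversely, the inverse of `ψ_6` is also its trace adjoint, and adjoint maps have the same slopes.
Comparing coefficients shows that the two graphs are not scalar multiples, which gives class two;
swapping the coordinates exchanges them, so there is a single `ΓL`-orbit. -/

open Finset

/-! ### Power sums over a finite field and digits in base `q`. -/

theorem sum_pow_div_pow {L : Type*} [Field L] [Fintype L] {A B : ℕ} (hA0 : 0 < A)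
    (hA : A < Fintype.card L - 1) (hB : B < Fintype.card L - 1) :
    ∑ x : L, x ^ A / x ^ B = if A = B then -1 else 0 := by
  classical
  have h1 : ∀ x : L, x ^ A / x ^ B = x ^ (A + (Fintype.card L - 1 - B)) := by
    intro x
    by_cases hx : x = 0
    · subst hx; simp [hA0.ne']
    · rw [div_eq_iff (pow_ne_zero _ hx), ← pow_add,
        show A + (Fintype.card L - 1 - B) + B = A + (Fintype.card L - 1) by omega, pow_add,
        FiniteField.pow_card_sub_one_eq_one x hx, mul_one]
  have h2 : ∑ x : L, x ^ (A + (Fintype.card L - 1 - B)) =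
      ∑ x : Lˣ, (x : L) ^ (A + (Fintype.card L - 1 - B)) := by
    symm
    refine Finset.sum_of_injOn (fun u : Lˣ => (u : L)) (fun a _ b _ h => Units.ext h)
      (fun _ _ => mem_univ _) (fun x _ hx => ?_) (fun _ _ => rfl)
    by_cases h0 : x = 0
    · subst h0; exact zero_pow (by omega)
    · exact absurd ⟨Units.mk0 x h0, by simp⟩ hx
  rw [sum_congr rfl fun x _ => h1 x, h2, FiniteField.sum_pow_units]
  congr 1
  rw [eq_iff_iff]
  constructor
  · rintro ⟨c, hc⟩
    -- The exponent lies strictly between `0` and twice `Fintype.card L - 1`.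
    have h3 : c = 1 := by
      have : c < 2 := by
        by_contra! h
        have := Nat.mul_le_mul_left (Fintype.card L - 1) h
        omega
      have : c ≠ 0 := by rintro rfl; omega
      omega
    subst h3; omega
  · rintro rfl
    exact ⟨1, by omega⟩

/-- Uniqueness of the digits in base `q`, in terms of sums of fewer than `q` powers of `q`. -/
theorem card_fiber_eq_of_sum_pow_eq {q k n : ℕ} (hk : k < q) (e φ : Fin k → Fin n)
    (h : ∑ i, q ^ (φ i : ℕ) = ∑ i, q ^ (e i : ℕ)) (j : Fin n) :
    #{i | φ i = j} = #{i | e i = j} := by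
  -- The multiplicities of the exponents are the digits: they are at most `k < q`, so there are no
  -- carries.
  have hdig : ∀ f : Fin k → Fin n, ∑ i, q ^ (f i : ℕ) =
      Nat.ofDigits q (List.ofFn fun j : Fin n => #{i | f i = j}) := by
    intro f
    rw [Nat.ofDigits_eq_sum_mapIdx, List.mapIdx_eq_ofFn, List.sum_ofFn]
    simp only [List.get_eq_getElem, List.getElem_ofFn]
    rw [← Finset.sum_fiberwise (s := univ) (g := f)]
    have : ∀ j, ∑ i with f i = j, q ^ (f i : ℕ) = #{i | f i = j} * q ^ (j : ℕ) := by
      intro j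
      rw [← smul_eq_mul, ← Finset.sum_const]
      exact Finset.sum_congr rfl fun i hi => by rw [(mem_filter.1 hi).2]
    rw [Finset.sum_congr rfl fun j _ => this j]
    refine Fintype.sum_equiv (finCongr (by simp)) _ _ fun j => ?_
    rfl
  rw [hdig, hdig] at h
  have hlt : ∀ f : Fin k → Fin n, ∀ l ∈ List.ofFn fun j : Fin n => #{i | f i = j}, l < q := by
    intro f l hl
    obtain ⟨j, rfl⟩ := List.mem_ofFn.1 hl
    exact ((card_filter_le _ _).trans (by simp)).trans_lt hk
  rcases Nat.lt_or_ge 1 q with hq | hq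
  · have := Nat.ofDigits_inj_of_len_eq hq (by simp) (hlt φ) (hlt e) h
    exact congrFun (List.ofFn_injective this) j
  · have : k = 0 := by omega
    subst this; simp

/-- As `e` is injective all digits are `0` or `1`, so `φ` takes each value of `e` exactly once. -/
theorem exists_perm_of_sum_pow_eq {q k n : ℕ} (hk : k < q) (e φ : Fin k → Fin n)
    (he : Function.Injective e) (h : ∑ i, q ^ (φ i : ℕ) = ∑ i, q ^ (e i : ℕ)) :
    ∃ σ : Equiv.Perm (Fin k), φ = e ∘ σ := by
  have hc := card_fiber_eq_of_sum_pow_eq hk e φ h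
  have hex : ∀ i, ∃ j, e j = φ i := by
    intro i
    have : 0 < #{i' | φ i' = φ i} := card_pos.2 ⟨i, by simp⟩
    rw [hc] at this
    obtain ⟨j, hj⟩ := card_pos.1 this
    exact ⟨j, by simpa using hj⟩
  choose s hs using hex
  have hinj : Function.Injective s := by
    intro i i' hii
    have h1 : φ i = φ i' := by rw [← hs, ← hs, hii]
    have h2 : #{j | φ j = φ i} ≤ 1 := by
      rw [hc, card_le_one]
      intro a ha b hb
      simp only [mem_filter, mem_univ, true_and] at ha hb
      exact he (ha.trans hb.symm)
    exact card_le_one.1 h2 i (by simp) i' (by simp [h1])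
  exact ⟨Equiv.ofBijective s (Finite.injective_iff_bijective.1 hinj),
    funext fun i => (hs i).symm⟩

theorem sum_pow_lt {q k n : ℕ} (hq : 1 < q) (hk : k < q) (hn : 2 ≤ n) (φ : Fin k → Fin n) :
    ∑ i, q ^ (φ i : ℕ) < q ^ n - 1 := by
  obtain ⟨m, rfl⟩ : ∃ m, n = m + 1 := ⟨n - 1, by omega⟩
  have h1 : ∑ i, q ^ (φ i : ℕ) ≤ k * q ^ m := by
    refine (Finset.sum_le_card_nsmul _ _ (q ^ m) fun i _ => ?_).trans (by simp)
    exact Nat.pow_le_pow_right (by omega) (by have := (φ i).2; omega)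
  have h2 : k * q ^ m + q ^ m ≤ q ^ (m + 1) := by
    rw [pow_succ]; nlinarith [Nat.zero_le (q ^ m)]
  have h3 : 1 < q ^ m := Nat.one_lt_pow (by omega) (by omega)
  omega

theorem sum_prod_monomial_div {L : Type*} [Field L] [Fintype L] {q k n : ℕ} (hk0 : 0 < k)
    (hk : k < q) (hn : 2 ≤ n) (hL : Fintype.card L = q ^ n) (e φ : Fin k → Fin n) :
    ∑ x : L, ∏ i, (x ^ q ^ (φ i : ℕ) / x ^ q ^ (e i : ℕ)) =
      if ∑ i, q ^ (φ i : ℕ) = ∑ i, q ^ (e i : ℕ) then -1 else 0 := by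
  simp only [prod_div_distrib, prod_pow_eq_pow_sum]
  refine sum_pow_div_pow ?_ (hL ▸ sum_pow_lt (by omega) hk hn φ)
    (hL ▸ sum_pow_lt (by omega) hk hn e)
  exact sum_pos (fun i _ => pow_pos (by omega) _) ⟨⟨0, hk0⟩, mem_univ _⟩

/-- The sum over `x` of a product of `q`-polynomials with coefficients `M i` divided by distinct
`q`-powers of `x` is the negative of a permanent. -/
theorem sum_prod_linearized_div {L : Type*} [Field L] [Fintype L] {q k n : ℕ} (hk0 : 0 < k)
    (hk : k < q) (hn : 2 ≤ n) (hL : Fintype.card L = q ^ n) (e : Fin k → Fin n)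
    (he : Function.Injective e) (M : Fin k → Fin n → L) :
    ∑ x : L, ∏ i, ((∑ j, M i j * x ^ q ^ (j : ℕ)) / x ^ q ^ (e i : ℕ)) =
      - ∑ σ : Equiv.Perm (Fin k), ∏ i, M i (e (σ i)) := by
  classical
  have h1 : ∀ x : L, ∏ i, ((∑ j, M i j * x ^ q ^ (j : ℕ)) / x ^ q ^ (e i : ℕ)) =
      ∑ φ : Fin k → Fin n, (∏ i, M i (φ i)) *
        ∏ i, (x ^ q ^ (φ i : ℕ) / x ^ q ^ (e i : ℕ)) := by
    intro x
    simp only [sum_div]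
    rw [prod_univ_sum]
    simp only [mul_div_assoc, prod_mul_distrib, Fintype.piFinset_univ]
  rw [sum_congr rfl fun x _ => h1 x, sum_comm]
  simp only [← mul_sum, sum_prod_monomial_div hk0 hk hn hL, mul_ite, mul_zero, mul_neg, mul_one]
  rw [← sum_neg_distrib]
  symm
  refine sum_of_injOn (fun σ : Equiv.Perm (Fin k) => e ∘ σ)
    (fun σ _ τ _ h => Equiv.ext fun i => he (congrFun h i)) (fun _ _ => mem_univ _)
    (fun φ _ hφ => if_neg fun h => hφ ?_) fun σ _ => ?_
  · obtain ⟨σ, rfl⟩ := exists_perm_of_sum_pow_eq hk e φ he h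
    exact ⟨σ, by simp⟩
  · rw [if_pos]
    · rfl
    · exact Equiv.sum_comp σ fun i => q ^ (e i : ℕ)

/-! ### Slopes, their power sums and the Dickson matrix. -/

section
variable {K L : Type*} [Field K] [Fintype K] [Field L] [Algebra K L]

/-- `m` is the slope of a point of the linear set defined by the graph of `f`. -/
def IsSlope (f : L →ₗ[K] L) (m : L) : Prop := ∃ x, x ≠ 0 ∧ f x = m * x

/-- Together with `0` these vectors form a nonzero `K`-subspace, whose order is a positive power of
`q` and vanishes in `L`. -/
theorem card_ne_zero_and_eq_mul [Fintype L] [DecidableEq L] (f : L →ₗ[K] L) {m : L}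
    (hm : IsSlope f m) : ((#{x : L | x ≠ 0 ∧ f x = m * x} : ℕ) : L) = -1 := by
  classical
  obtain ⟨y, hy, hym⟩ := hm
  let V : Submodule K L := LinearMap.ker (f - LinearMap.mulLeft K m)
  have hV : ∀ x, x ∈ V ↔ f x = m * x := fun x => by simp [V, sub_eq_zero]
  have hpos : Module.finrank K V ≠ 0 := by
    intro h
    rw [Submodule.finrank_eq_zero] at h
    have : y ∈ V := (hV y).2 hym
    rw [h] at this
    exact hy (by simpa using this)
  have h0 : ((Fintype.card V : ℕ) : L) = 0 := by
    rw [Module.card_eq_pow_finrank (K := K), Nat.cast_pow, ← map_natCast (algebraMap K L),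
      FiniteField.cast_card_eq_zero, map_zero, zero_pow hpos]
  have h1 : Fintype.card V = #{x : L | x ≠ 0 ∧ f x = m * x} + 1 := by
    rw [Fintype.card_subtype, ← card_erase_add_one (a := (0 : L)) (by simp)]
    congr 2
    ext x; simp [hV]
  rw [h1] at h0
  push_cast at h0
  linear_combination h0

-- Group the nonzero `x` by the value of `f x / x`: each slope is attained `-1` times in `L`,
-- whatever its multiplicity. This makes the left side an invariant of the linear set.
open Classical in
theorem sum_slope_pow [Fintype L] (f : L →ₗ[K] L) {d : ℕ} (hd : 0 < d) :
    ∑ x, (f x / x) ^ d = - ∑ m with IsSlope f m, m ^ d := by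
  have h1 : ∑ x, (f x / x) ^ d = ∑ x with x ≠ 0, (f x / x) ^ d := by
    rw [sum_filter]
    refine sum_congr rfl fun x _ => ?_
    split_ifs with h
    · rfl
    · rw [not_not.1 h]; simp [hd.ne']
  rw [h1, ← sum_fiberwise (g := fun x => f x / x), sum_filter, ← sum_neg_distrib]
  refine sum_congr rfl fun m _ => ?_
  have h2 : ({x ∈ {x : L | x ≠ 0} | f x / x = m} : Finset L) =
      ({x | x ≠ 0 ∧ f x = m * x} : Finset L) := by
    ext x
    simp only [mem_filter, mem_univ, true_and]
    exact and_congr_right fun hx => div_eq_iff hx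
  have h3 : ∑ x ∈ {x ∈ {x : L | x ≠ 0} | f x / x = m}, (f x / x) ^ d =
      (#{x : L | x ≠ 0 ∧ f x = m * x} : ℕ) * m ^ d := by
    rw [← h2, ← nsmul_eq_mul, ← sum_const]
    exact sum_congr rfl fun x hx => by rw [(mem_filter.1 hx).2]
  rw [h3]
  split_ifs with hm
  · rw [card_ne_zero_and_eq_mul f hm]; ring
  · have : ({x | x ≠ 0 ∧ f x = m * x} : Finset L) = ∅ := by
      ext x
      simp only [mem_filter, mem_univ, true_and, notMem_empty, iff_false]
      exact fun hx => hm ⟨x, hx⟩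
    rw [this]; simp

theorem pow_card_pow_mod [Finite L] (hL : Module.finrank K L = 6) (x : L) (a : ℕ) :
    x ^ Fintype.card K ^ (a % 6) = x ^ Fintype.card K ^ a := by
  have := Fintype.ofFinite L
  have hc : Fintype.card L = Fintype.card K ^ 6 := hL ▸ Module.card_eq_pow_finrank
  conv_rhs => rw [← Nat.div_add_mod a 6, pow_add, pow_mul (Fintype.card K), ← hc, pow_mul,
    FiniteField.pow_card_pow]

/-- The Dickson matrix of the `q`-polynomial with coefficients `b`. -/
def dicksonMatrix (q : ℕ) (b : Fin 6 → L) (i j : Fin 6) : L := b (j - i) ^ q ^ (i : ℕ)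

theorem linearized_pow [Finite L] (hL : Module.finrank K L = 6) (b : Fin 6 → L) (i : Fin 6)
    (x : L) : (∑ k, b k * x ^ Fintype.card K ^ (k : ℕ)) ^ Fintype.card K ^ (i : ℕ) =
      ∑ j, dicksonMatrix (Fintype.card K) b i j * x ^ Fintype.card K ^ (j : ℕ) := by
  rw [← qPow_apply, map_sum]
  refine Fintype.sum_equiv (Equiv.addRight i) _ _ fun k => ?_
  simp only [qPow_apply, mul_pow, dicksonMatrix, Equiv.coe_addRight, add_sub_cancel_right]
  rw [Fin.val_add, pow_card_pow_mod hL, ← pow_mul, ← pow_add]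

theorem linearIndependent_qPow [Finite L] (hL : Module.finrank K L = 6) :
    LinearIndependent L fun k : Fin 6 => qPow K L k := by
  refine (linearIndependent_toLinearMap K L L).comp
    (fun k : Fin 6 => FiniteField.frobeniusAlgHom K L ^ (k : ℕ)) fun i j hij => Fin.ext ?_
  have ho := FiniteField.orderOf_frobeniusAlgHom K L
  exact pow_injOn_Iio_orderOf (by simp [ho, hL]) (by simp [ho, hL]) hij

theorem linearized_coeff_unique [Finite L] (hL : Module.finrank K L = 6) {a b : Fin 6 → L}
    (h : ∀ x : L, ∑ k, a k * x ^ Fintype.card K ^ (k : ℕ) =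
      ∑ k, b k * x ^ Fintype.card K ^ (k : ℕ)) : a = b := by
  refine (linearIndependent_qPow (K := K) hL).fintypeLinearCombination_injective ?_
  refine LinearMap.ext fun x => ?_
  simpa [Fintype.linearCombination_apply, qPow_apply] using h x

theorem exists_linearized_coeff [Finite L] (hL : Module.finrank K L = 6) (f : L →ₗ[K] L) :
    ∃ b : Fin 6 → L, ∀ x, f x = ∑ k, b k * x ^ Fintype.card K ^ (k : ℕ) := by
  have hfin : FiniteDimensional K L := Module.finite_of_finrank_pos (by omega)
  have hli := linearIndependent_qPow (K := K) hL
  have hspan := hli.span_eq_top_of_card_eq_finrank' (by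
    rw [Module.finrank_linearMap_self, hL, Fintype.card_fin])
  obtain ⟨b, hb⟩ := (Submodule.mem_span_range_iff_exists_fun L).1
    (hspan ▸ Submodule.mem_top : f ∈ _)
  refine ⟨b, fun x => ?_⟩
  rw [← hb]
  simp [qPow_apply]

/-- The permanents of the principal submatrices of order less than `q` of the Dickson matrix depend
only on the linear set. -/
theorem dicksonMatrix_permanent_eq [Fintype L] (hL : Module.finrank K L = 6) {f g : L →ₗ[K] L}
    {a b : Fin 6 → L} (ha : ∀ x, f x = ∑ k, a k * x ^ Fintype.card K ^ (k : ℕ))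
    (hb : ∀ x, g x = ∑ k, b k * x ^ Fintype.card K ^ (k : ℕ))
    (hfg : ∀ m, IsSlope f m ↔ IsSlope g m) {k : ℕ} (hk0 : 0 < k) (hk : k < Fintype.card K)
    (e : Fin k → Fin 6) (he : Function.Injective e) :
    ∑ σ : Equiv.Perm (Fin k), ∏ i, dicksonMatrix (Fintype.card K) a (e i) (e (σ i)) =
      ∑ σ : Equiv.Perm (Fin k), ∏ i, dicksonMatrix (Fintype.card K) b (e i) (e (σ i)) := by
  classical
  have hc : Fintype.card L = Fintype.card K ^ 6 := hL ▸ Module.card_eq_pow_finrank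
  have key : ∀ (h : L →ₗ[K] L) (c : Fin 6 → L),
      (∀ x, h x = ∑ k, c k * x ^ Fintype.card K ^ (k : ℕ)) →
      ∑ σ : Equiv.Perm (Fin k), ∏ i, dicksonMatrix (Fintype.card K) c (e i) (e (σ i)) =
        ∑ m with IsSlope h m, m ^ ∑ i, Fintype.card K ^ (e i : ℕ) := by
    intro h c hcoef
    have h1 := sum_prod_linearized_div hk0 hk (by norm_num) hc e he
      fun i => dicksonMatrix (Fintype.card K) c (e i)
    rw [← neg_eq_iff_eq_neg] at h1
    rw [← h1, ← neg_eq_iff_eq_neg.2 (sum_slope_pow h _)]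
    · congr 1
      refine sum_congr rfl fun x _ => ?_
      rw [← prod_pow_eq_pow_sum]
      refine prod_congr rfl fun i _ => ?_
      rw [← linearized_pow hL, div_pow, hcoef]
    · exact sum_pos (fun i _ => pow_pos Fintype.card_pos _) ⟨⟨0, hk0⟩, mem_univ _⟩
  rw [key f a ha, key g b hb]
  simp only [hfg]
end

/-! ### Explicit permanents of order at most four. -/

theorem sum_perm_succ {R : Type*} [AddCommMonoid R] {n : ℕ} (F : Equiv.Perm (Fin (n + 1)) → R) :
    ∑ σ, F σ = ∑ p, ∑ τ : Equiv.Perm (Fin n), F (Equiv.Perm.decomposeFin.symm (p, τ)) := by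
  rw [← Fintype.sum_prod_type']
  exact (Equiv.sum_comp Equiv.Perm.decomposeFin.symm F).symm

theorem sum_perm_prod_succ {R : Type*} [CommSemiring R] {n : ℕ}
    (M : Fin (n + 1) → Fin (n + 1) → R) :
    ∑ σ : Equiv.Perm (Fin (n + 1)), ∏ i, M i (σ i) =
      ∑ p, M 0 p * ∑ τ : Equiv.Perm (Fin n), ∏ i : Fin n, M i.succ (Equiv.swap 0 p (τ i).succ) := by
  rw [sum_perm_succ]
  simp [Fin.prod_univ_succ, mul_sum]

theorem sum_perm_prod_one {R : Type*} [CommSemiring R] (M : Fin 1 → Fin 1 → R) :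
    ∑ σ : Equiv.Perm (Fin 1), ∏ i, M i (σ i) = M 0 0 := by
  simp

theorem sum_perm_prod_two {R : Type*} [CommSemiring R] (M : Fin 2 → Fin 2 → R) :
    ∑ σ : Equiv.Perm (Fin 2), ∏ i, M i (σ i) = M 0 0 * M 1 1 + M 0 1 * M 1 0 := by
  rw [sum_perm_prod_succ]
  simp only [fun p => sum_perm_prod_one fun i j => M i.succ (Equiv.swap 0 p j.succ)]
  refine (Fin.sum_univ_two _).trans ?_
  rfl

theorem sum_perm_prod_three {R : Type*} [CommSemiring R] (M : Fin 3 → Fin 3 → R) :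
    ∑ σ : Equiv.Perm (Fin 3), ∏ i, M i (σ i) = M 0 0 * (M 1 1 * M 2 2 + M 1 2 * M 2 1)
      + M 0 1 * (M 1 0 * M 2 2 + M 1 2 * M 2 0) + M 0 2 * (M 1 1 * M 2 0 + M 1 0 * M 2 1) := by
  rw [sum_perm_prod_succ]
  simp only [fun p => sum_perm_prod_two fun i j => M i.succ (Equiv.swap 0 p j.succ)]
  refine (Fin.sum_univ_three _).trans ?_
  rfl

theorem sum_perm_prod_four {R : Type*} [CommSemiring R] (M : Fin 4 → Fin 4 → R) :
    ∑ σ : Equiv.Perm (Fin 4), ∏ i, M i (σ i) =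
      M 0 0 * (M 1 1 * (M 2 2 * M 3 3 + M 2 3 * M 3 2) +
        M 1 2 * (M 2 1 * M 3 3 + M 2 3 * M 3 1) + M 1 3 * (M 2 2 * M 3 1 + M 2 1 * M 3 2))
      + M 0 1 * (M 1 0 * (M 2 2 * M 3 3 + M 2 3 * M 3 2) +
        M 1 2 * (M 2 0 * M 3 3 + M 2 3 * M 3 0) + M 1 3 * (M 2 2 * M 3 0 + M 2 0 * M 3 2))
      + M 0 2 * (M 1 1 * (M 2 0 * M 3 3 + M 2 3 * M 3 0) +
        M 1 0 * (M 2 1 * M 3 3 + M 2 3 * M 3 1) + M 1 3 * (M 2 0 * M 3 1 + M 2 1 * M 3 0))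
      + M 0 3 * (M 1 1 * (M 2 2 * M 3 0 + M 2 0 * M 3 2) +
        M 1 2 * (M 2 1 * M 3 0 + M 2 0 * M 3 1) + M 1 0 * (M 2 2 * M 3 1 + M 2 1 * M 3 2)) := by
  rw [sum_perm_prod_succ]
  simp only [fun p => sum_perm_prod_three fun i j => M i.succ (Equiv.swap 0 p j.succ)]
  refine (Fin.sum_univ_four _).trans ?_
  rfl

/-- The coefficients of `ψ_6` for `ε = 1` and those of its inverse for `ε = -1`. -/
def psiCoeff {L : Type*} [Field L] (ε : L) : Fin 6 → L :=
  ![0, 2⁻¹, ε * 2⁻¹, 0, -(ε * 2⁻¹), 2⁻¹]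

/-! ### Coefficient relations forced by the linear set. -/

section
variable {K L : Type*} [Field K] [Fintype K] [Field L] [Algebra K L]

theorem five_le_card (hq : Fintype.card K ≡ 1 [MOD 4]) : 5 ≤ Fintype.card K := by
  have := Fintype.one_lt_card (α := K)
  unfold Nat.ModEq at hq
  omega

variable (K L) in
theorem two_ne_zero_of_card (hq : Fintype.card K ≡ 1 [MOD 4]) : (2 : L) ≠ 0 := by
  intro h
  have h1 : ((Fintype.card K : ℕ) : L) = 0 := by
    rw [← map_natCast (algebraMap K L), FiniteField.cast_card_eq_zero, map_zero]
  have h2 : Fintype.card K = 2 * (Fintype.card K / 2) + 1 := by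
    unfold Nat.ModEq at hq
    omega
  rw [h2] at h1
  push_cast at h1
  rw [h, zero_mul, zero_add] at h1
  exact one_ne_zero h1

variable (K) in
theorem algebraMap_pow_card_pow (x : K) (i : ℕ) :
    (algebraMap K L x) ^ Fintype.card K ^ i = algebraMap K L x := by
  rw [← map_pow, FiniteField.pow_card_pow]

-- The index sets `{0}` and `{0, 3}` kill `b 0` and `b 3`; `{0, 1}` and `{0, 2}` then give the two
-- products, and the two 3-cycles on `{0, 1, 2}` the cubic relation. On `{0, 2, 3, 4}`, as `b 0 = b
-- 3 = 0`, there remain two double transpositions, known from order two, and a 4-cycle with its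
-- inverse. Order four needs `q ≥ 5`.
set_option linter.unusedSimpArgs false in
theorem coeff_relations [Fintype L] (hL : Module.finrank K L = 6)
    (hq : Fintype.card K ≡ 1 [MOD 4]) {f g : L →ₗ[K] L} {b : Fin 6 → L}
    (hf : ∀ x, f x = ∑ k, psiCoeff 1 k * x ^ Fintype.card K ^ (k : ℕ))
    (hg : ∀ x, g x = ∑ k, b k * x ^ Fintype.card K ^ (k : ℕ))
    (hfg : ∀ m, IsSlope f m ↔ IsSlope g m) :
    b 0 = 0 ∧ b 3 = 0 ∧ b 1 * b 5 ^ Fintype.card K = 4⁻¹ ∧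
    b 2 * b 4 ^ Fintype.card K ^ 2 = -4⁻¹ ∧
    b 1 * b 1 ^ Fintype.card K * b 4 ^ Fintype.card K ^ 2 +
      b 2 * b 5 ^ Fintype.card K * b 5 ^ Fintype.card K ^ 2 = 0 ∧
    b 2 * b 1 ^ Fintype.card K ^ 2 * b 1 ^ Fintype.card K ^ 3 * b 2 ^ Fintype.card K ^ 4 +
      b 4 * b 5 ^ Fintype.card K ^ 4 * b 5 ^ Fintype.card K ^ 3 * b 4 ^ Fintype.card K ^ 2 =
      8⁻¹ := by
  have h2 := two_ne_zero_of_card K L hq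
  have h5 := five_le_card hq
  have hhalf : ∀ i, (2⁻¹ : L) ^ Fintype.card K ^ i = 2⁻¹ := fun i => by
    simpa only [map_inv₀, map_ofNat] using algebraMap_pow_card_pow (L := L) K 2⁻¹ i
  have hq0 : ∀ i, Fintype.card K ^ i ≠ 0 := fun i => pow_ne_zero _ (by omega)
  have hneg : ∀ i, (-2⁻¹ : L) ^ Fintype.card K ^ i = -2⁻¹ := fun i => by
    simpa only [map_neg, map_inv₀, map_ofNat] using algebraMap_pow_card_pow (L := L) K (-2⁻¹) i
  have hq01 : Fintype.card K ≠ 0 := by omega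
  have hhalf1 := hhalf 1
  have hneg1 := hneg 1
  rw [pow_one] at hhalf1 hneg1
  have key := fun {k : ℕ} => dicksonMatrix_permanent_eq (k := k) hL hf hg hfg
  have m1 : (-1 : Fin 6) = 5 := rfl
  have m2 : (-2 : Fin 6) = 4 := rfl
  have m3 : (-3 : Fin 6) = 3 := rfl
  have m4 : (-4 : Fin 6) = 2 := rfl
  have e1 := key (by norm_num) (by omega) ![0] (by decide)
  simp only [fun c : Fin 6 → L => sum_perm_prod_one fun i j =>
    dicksonMatrix (Fintype.card K) c (![0] i) (![0] j)] at e1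
  simp [dicksonMatrix, psiCoeff, hhalf, hneg, hhalf1, hneg1, hq0, hq01, m1, m2, m3, m4] at e1
  have e2 := key (by norm_num) (by omega) ![0, 1] (by decide)
  simp only [fun c : Fin 6 → L => sum_perm_prod_two fun i j =>
    dicksonMatrix (Fintype.card K) c (![0, 1] i) (![0, 1] j)] at e2
  simp [dicksonMatrix, psiCoeff, hhalf, hneg, hhalf1, hneg1, hq0, hq01, m1, m2, m3, m4] at e2
  have e3 := key (by norm_num) (by omega) ![0, 2] (by decide)
  simp only [fun c : Fin 6 → L => sum_perm_prod_two fun i j =>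
    dicksonMatrix (Fintype.card K) c (![0, 2] i) (![0, 2] j)] at e3
  simp [dicksonMatrix, psiCoeff, hhalf, hneg, hhalf1, hneg1, hq0, hq01, m1, m2, m3, m4] at e3
  have e4 := key (by norm_num) (by omega) ![0, 3] (by decide)
  simp only [fun c : Fin 6 → L => sum_perm_prod_two fun i j =>
    dicksonMatrix (Fintype.card K) c (![0, 3] i) (![0, 3] j)] at e4
  simp [dicksonMatrix, psiCoeff, hhalf, hneg, hhalf1, hneg1, hq0, hq01, m1, m2, m3, m4] at e4
  have e5 := key (by norm_num) (by omega) ![0, 1, 2] (by decide)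
  simp only [fun c : Fin 6 → L => sum_perm_prod_three fun i j =>
    dicksonMatrix (Fintype.card K) c (![0, 1, 2] i) (![0, 1, 2] j)] at e5
  simp [dicksonMatrix, psiCoeff, hhalf, hneg, hhalf1, hneg1, hq0, hq01, m1, m2, m3, m4] at e5
  have e6 := key (by norm_num) (by omega) ![0, 2, 3, 4] (by decide)
  simp only [fun c : Fin 6 → L => sum_perm_prod_four fun i j =>
    dicksonMatrix (Fintype.card K) c (![0, 2, 3, 4] i) (![0, 2, 3, 4] j)] at e6
  simp [dicksonMatrix, psiCoeff, hhalf, hneg, hhalf1, hneg1, hq0, hq01, m1, m2, m3, m4] at e6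
  have b0 : b 0 = 0 := e1.symm
  have b3 : b 3 = 0 := by
    rw [b0, zero_mul, zero_add, eq_comm] at e4
    rcases mul_eq_zero.1 e4 with h | h
    · exact h
    · exact pow_eq_zero_iff (hq0 3) |>.1 h
  simp only [b0, b3, zero_mul, zero_add, add_zero, mul_zero, zero_pow hq01, zero_pow (hq0 _)]
    at e2 e3 e5 e6
  have h4 : (4 : L) = 2 * 2 := by norm_num
  have h8 : (8 : L) = 2 * 2 * 2 := by norm_num
  have e2' : b 1 * b 5 ^ Fintype.card K = 4⁻¹ := by rw [h4, ← e2, mul_inv]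
  have e3' : b 2 * b 4 ^ Fintype.card K ^ 2 = -4⁻¹ := by rw [h4, ← e3, mul_inv]
  have hquarter : ∀ i, (4⁻¹ : L) ^ Fintype.card K ^ i = 4⁻¹ := fun i => by
    simpa only [map_inv₀, map_ofNat] using algebraMap_pow_card_pow (L := L) K 4⁻¹ i
  have hquarter' : ∀ i, (-4⁻¹ : L) ^ Fintype.card K ^ i = -4⁻¹ := fun i => by
    simpa only [map_neg, map_inv₀, map_ofNat] using algebraMap_pow_card_pow (L := L) K (-4⁻¹) i
  have p1 : ∀ i, b 1 ^ Fintype.card K ^ i * b 5 ^ Fintype.card K ^ (i + 1) = 4⁻¹ := fun i => by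
    rw [← hquarter i, ← e2', mul_pow, ← pow_mul, ← pow_succ']
  have p2 : b 4 * b 2 ^ Fintype.card K ^ 4 = -4⁻¹ := by
    have := pow_card_pow_mod hL (b 4) 6
    norm_num at this
    rw [← hquarter' 4, ← e3', mul_pow, ← pow_mul, ← pow_add, ← this, mul_comm]
  refine ⟨b0, b3, e2', e3', by linear_combination -e5, ?_⟩
  have p12 := p1 2
  have p13 := p1 3
  norm_num at p12 p13
  have : (8 : L)⁻¹ = 2 * 4⁻¹ * 4⁻¹ := by rw [h4, h8]; field_simp
  rw [this]
  linear_combination -e6 - b 1 ^ Fintype.card K ^ 3 * b 5 ^ Fintype.card K ^ 4 * e3' + 4⁻¹ * p13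
    - b 1 ^ Fintype.card K ^ 2 * b 5 ^ Fintype.card K ^ 3 * p2 + 4⁻¹ * p12
end

/-! ### Solving the relations by Hilbert 90. -/

section
variable {K L : Type*} [Field K] [Fintype K] [Field L] [Algebra K L]

/-- In a cyclic group of order `d * s`, the elements killed by `s` are the `d`-th powers. -/
theorem exists_pow_sub_one_eq {L : Type*} [Field L] [Fintype L] {d s : ℕ} (hs : 0 < s)
    (h : Fintype.card L - 1 = d * s) {c : L} (hc : c ^ s = 1) : ∃ l : L, l ≠ 0 ∧ l ^ d = c := by
  classical
  have hc0 : c ≠ 0 := by rintro rfl; simp [hs.ne'] at hc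
  obtain ⟨g, hg⟩ := IsCyclic.exists_monoid_generator (α := Lˣ)
  obtain ⟨k, hk⟩ := hg (Units.mk0 c hc0)
  have ho : orderOf g = d * s := by
    rw [orderOf_eq_card_of_forall_mem_powers hg, Nat.card_eq_fintype_card, Fintype.card_units, h]
  have h1 : g ^ (k * s) = 1 := by
    rw [pow_mul]
    refine Units.ext ?_
    have := congrArg Units.val hk
    simp only [Units.val_mk0] at this
    rw [Units.val_pow_eq_pow_val, this, hc, Units.val_one]
  obtain ⟨j, rfl⟩ : d ∣ k := Nat.dvd_of_mul_dvd_mul_right hs (ho ▸ orderOf_dvd_of_pow_eq_one h1)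
  refine ⟨((g ^ j : Lˣ) : L), Units.ne_zero _, ?_⟩
  rw [← Units.val_pow_eq_pow_val, ← pow_mul, mul_comm]
  exact congrArg Units.val hk

/-- Hilbert 90: an element of norm one is a `(q - 1)`-th power, and the inverse of such a root is
the required `l`. -/
theorem exists_pow_card_mul_eq [Fintype L] (hL : Module.finrank K L = 6) {c : L}
    (hc : c * c ^ Fintype.card K * c ^ Fintype.card K ^ 2 * c ^ Fintype.card K ^ 3 *
      c ^ Fintype.card K ^ 4 * c ^ Fintype.card K ^ 5 = 1) :
    ∃ l : L, l ≠ 0 ∧ c * l ^ Fintype.card K = l := by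
  have hcard : Fintype.card L = Fintype.card K ^ 6 := hL ▸ Module.card_eq_pow_finrank
  have hq : 0 < Fintype.card K := Fintype.card_pos
  obtain ⟨l, hl, h⟩ := exists_pow_sub_one_eq (L := L) (d := Fintype.card K - 1)
    (s := ∑ i ∈ range 6, Fintype.card K ^ i) (sum_pos (fun i _ => pow_pos hq i) (by simp))
    (by rw [hcard, mul_comm, geom_sum_mul_of_one_le hq]) (c := c)
    (by rw [← hc]; simp only [sum_range_succ, pow_add, sum_range_zero]; ring)
  refine ⟨l⁻¹, inv_ne_zero hl, ?_⟩
  rw [← h, inv_pow, ← div_eq_mul_inv, div_eq_iff (pow_ne_zero _ hl), ← Nat.sub_add_cancel hq,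
    pow_succ, Nat.add_sub_cancel]
  field_simp

/-- Everything is expressed through `c = 2 * b 1`: the order-two relations give `b 5` from `c` and
`b 4` from `b 2`, and the cubic one gives `b 2` up to the sign `ε`. The quartic one makes the norm
of `c` equal to one, so `c = l / l ^ q`. -/
theorem exists_scalar_of_coeff_relations [Fintype L] (hL : Module.finrank K L = 6)
    (hq : Fintype.card K ≡ 1 [MOD 4]) {b : Fin 6 → L}
    (h0 : b 0 = 0) (h3 : b 3 = 0) (h1 : b 1 * b 5 ^ Fintype.card K = 4⁻¹)
    (h2 : b 2 * b 4 ^ Fintype.card K ^ 2 = -4⁻¹)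
    (h4 : b 1 * b 1 ^ Fintype.card K * b 4 ^ Fintype.card K ^ 2 +
      b 2 * b 5 ^ Fintype.card K * b 5 ^ Fintype.card K ^ 2 = 0)
    (h5 : b 2 * b 1 ^ Fintype.card K ^ 2 * b 1 ^ Fintype.card K ^ 3 * b 2 ^ Fintype.card K ^ 4 +
      b 4 * b 5 ^ Fintype.card K ^ 4 * b 5 ^ Fintype.card K ^ 3 * b 4 ^ Fintype.card K ^ 2 =
      8⁻¹) :
    ∃ l : L, l ≠ 0 ∧ ∃ ε : L, (ε = 1 ∨ ε = -1) ∧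
      ∀ k, b k = l * psiCoeff ε k * l⁻¹ ^ Fintype.card K ^ (k : ℕ) := by
  have two := two_ne_zero_of_card K L hq
  have four : (4 : L) ≠ 0 := by
    rw [show (4 : L) = 2 * 2 by norm_num]; exact mul_ne_zero two two
  have eight : (8 : L) ≠ 0 := by
    rw [show (8 : L) = 2 * 4 by norm_num]; exact mul_ne_zero two four
  have hhalf : ∀ i, (2 : L) ^ Fintype.card K ^ i = 2 := fun i => by
    simpa only [map_ofNat] using algebraMap_pow_card_pow (L := L) K 2 i
  have pp : ∀ (x : L) i j, (x ^ Fintype.card K ^ i) ^ Fintype.card K ^ j =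
    x ^ Fintype.card K ^ (i + j) := fun x i j => by rw [← pow_mul, ← pow_add]
  have p6 : ∀ x : L, x ^ Fintype.card K ^ 6 = x := fun x => by
    simpa using (pow_card_pow_mod hL x 6).symm
  obtain ⟨c, hc⟩ : ∃ c, c = 2 * b 1 := ⟨_, rfl⟩
  have b1 : ∀ i, 2 * b 1 ^ Fintype.card K ^ i = c ^ Fintype.card K ^ i := fun i => by
    rw [hc, mul_pow, hhalf]
  have c0 : c ≠ 0 := by
    rintro rfl
    have : b 1 = 0 := by simpa [two] using hc.symm
    rw [this, zero_mul] at h1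
    exact inv_ne_zero four h1.symm
  have b5 : ∀ i, 2 * c ^ Fintype.card K ^ i * b 5 ^ Fintype.card K ^ (i + 1) = 1 := fun i => by
    have : 2 * c * b 5 ^ Fintype.card K = 1 := by
      rw [hc]; field_simp at h1; linear_combination h1
    have := congrArg (· ^ Fintype.card K ^ i) this
    simp only [mul_pow, hhalf, one_pow] at this
    rw [← this, pow_succ', pow_mul (b 5)]
  obtain ⟨ε, hε, hb2⟩ : ∃ ε : L, (ε = 1 ∨ ε = -1) ∧ 2 * b 2 = ε * (c * c ^ Fintype.card K) := by
    have e0 := b5 0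
    have e1 := b5 1
    have e2 := b1 1
    simp only [pow_zero, pow_one, zero_add, one_add_one_eq_two] at e0 e1 e2
    have : (2 * b 2) ^ 2 = (c * c ^ Fintype.card K) ^ 2 := by
      have h2' : 4 * (b 2 * b 4 ^ Fintype.card K ^ 2) = -1 := by rw [h2]; field_simp
      have h4' : c * c ^ Fintype.card K * b 4 ^ Fintype.card K ^ 2 +
          4 * b 2 * b 5 ^ Fintype.card K * b 5 ^ Fintype.card K ^ 2 = 0 := by
        linear_combination 4 * h4 + b 4 ^ Fintype.card K ^ 2 * c ^ Fintype.card K * hc -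
          b 4 ^ Fintype.card K ^ 2 * 2 * b 1 * e2
      linear_combination 4 * c * c ^ Fintype.card K * b 2 * h4' -
        (c * c ^ Fintype.card K) ^ 2 * h2' -
        4 * b 2 ^ 2 * ((2 * c ^ Fintype.card K * b 5 ^ Fintype.card K ^ 2) * e0 + e1)
    rcases sq_eq_sq_iff_eq_or_eq_neg.1 this with h | h
    · exact ⟨1, Or.inl rfl, by rw [h, one_mul]⟩
    · exact ⟨-1, Or.inr rfl, by rw [h]; ring⟩
  have hε2 : ε * ε = 1 := by rcases hε with rfl | rfl <;> ring
  have hεi : ∀ i, ε ^ Fintype.card K ^ i = ε := fun i => by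
    rcases hε with rfl | rfl
    · simp
    · simpa only [map_neg, map_one] using algebraMap_pow_card_pow (L := L) K (-1) i
  have hnegεi : ∀ i, (-ε) ^ Fintype.card K ^ i = -ε := fun i => by
    rcases hε with rfl | rfl
    · simpa only [map_neg, map_one] using algebraMap_pow_card_pow (L := L) K (-1) i
    · simp
  have b2 : ∀ i, 2 * b 2 ^ Fintype.card K ^ i =
      ε * (c ^ Fintype.card K ^ i * c ^ Fintype.card K ^ (i + 1)) := fun i => by
    have := congrArg (· ^ Fintype.card K ^ i) hb2
    simp only [mul_pow, hhalf, hεi] at this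
    rw [this, pow_succ', pow_mul c]
  have b4 : ∀ i, 2 * (c ^ Fintype.card K ^ i * c ^ Fintype.card K ^ (i + 1)) *
      b 4 ^ Fintype.card K ^ (i + 2) = -ε := fun i => by
    have h2' : 4 * (b 2 * b 4 ^ Fintype.card K ^ 2) = -1 := by rw [h2]; field_simp
    have h : 2 * (c * c ^ Fintype.card K) * b 4 ^ Fintype.card K ^ 2 = -ε := by
      linear_combination ε * h2' - 2 * c * c ^ Fintype.card K * b 4 ^ Fintype.card K ^ 2 * hε2 -
        2 * ε * b 4 ^ Fintype.card K ^ 2 * hb2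
    have := congrArg (· ^ Fintype.card K ^ i) h
    simp only [mul_pow, hhalf, hnegεi] at this
    rw [← this, pow_succ', pow_mul c, pp, add_comm 2 i]
  have hN : c * c ^ Fintype.card K * c ^ Fintype.card K ^ 2 * c ^ Fintype.card K ^ 3 *
      c ^ Fintype.card K ^ 4 * c ^ Fintype.card K ^ 5 = 1 := by
    have b20 := b2 0
    have b40 := b4 0
    have b44 := b4 4
    simp only [pow_zero, pow_one, zero_add, p6, Nat.reduceAdd] at b20 b40 b44
    have t1 : 16 * (b 2 * b 1 ^ Fintype.card K ^ 2 * b 1 ^ Fintype.card K ^ 3 *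
        b 2 ^ Fintype.card K ^ 4) = c * c ^ Fintype.card K * c ^ Fintype.card K ^ 2 *
        c ^ Fintype.card K ^ 3 * c ^ Fintype.card K ^ 4 * c ^ Fintype.card K ^ 5 :=
      calc _ = (2 * b 2) * (2 * b 1 ^ Fintype.card K ^ 2) * (2 * b 1 ^ Fintype.card K ^ 3) *
            (2 * b 2 ^ Fintype.card K ^ 4) := by ring
        _ = _ := by
          rw [b20, b1, b1, b2]
          linear_combination (c * c ^ Fintype.card K * c ^ Fintype.card K ^ 2 *
            c ^ Fintype.card K ^ 3 * c ^ Fintype.card K ^ 4 * c ^ Fintype.card K ^ 5) * hε2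
    have t2 : (c * c ^ Fintype.card K * c ^ Fintype.card K ^ 2 * c ^ Fintype.card K ^ 3 *
        c ^ Fintype.card K ^ 4 * c ^ Fintype.card K ^ 5) * (16 * (b 4 * b 5 ^ Fintype.card K ^ 4 *
        b 5 ^ Fintype.card K ^ 3 * b 4 ^ Fintype.card K ^ 2)) = 1 :=
      calc _ = (2 * (c ^ Fintype.card K ^ 4 * c ^ Fintype.card K ^ 5) * b 4) *
            (2 * (c * c ^ Fintype.card K) * b 4 ^ Fintype.card K ^ 2) *
            (2 * c ^ Fintype.card K ^ 2 * b 5 ^ Fintype.card K ^ 3) *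
            (2 * c ^ Fintype.card K ^ 3 * b 5 ^ Fintype.card K ^ 4) := by ring
        _ = 1 := by rw [b44, b40, b5, b5]; linear_combination hε2
    -- With `N` the norm of `c`, `t1`, `t2` and `h5` say `N + 1 / N = 2`, hence `(N - 1) ^ 2 = 0`.
    have h16 : (16 : L) * 8⁻¹ = 2 := by
      rw [show (16 : L) = 2 * 8 by norm_num, mul_assoc, mul_inv_cancel₀ eight, mul_one]
    rw [← t1] at t2 ⊢
    rw [← sub_eq_zero]
    refine pow_eq_zero_iff two_ne_zero |>.1 ?_
    linear_combination 16 * (b 2 * b 1 ^ Fintype.card K ^ 2 * b 1 ^ Fintype.card K ^ 3 *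
        b 2 ^ Fintype.card K ^ 4) * (16 * h5 + h16) - t2
  obtain ⟨l, l0, hl⟩ := exists_pow_card_mul_eq hL hN
  have hli : ∀ i, c ^ Fintype.card K ^ i * l ^ Fintype.card K ^ (i + 1) = l ^ Fintype.card K ^ i :=
    fun i => by
      have := congrArg (· ^ Fintype.card K ^ i) hl
      simp only [mul_pow] at this
      rw [← this, pow_succ', pow_mul l]
  refine ⟨l, l0, ε, hε, fun k => ?_⟩
  have li : ∀ i, l ^ Fintype.card K ^ i ≠ 0 := fun i => pow_ne_zero _ l0
  rw [inv_pow, ← div_eq_mul_inv, eq_div_iff (li _)]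
  have l1 := hli 0
  have l2 := hli 1
  have l4 := hli 4
  have l5 := hli 5
  have b20 := b2 0
  have b44 := b4 4
  have b55 := b5 5
  simp only [pow_zero, pow_one, zero_add, p6, Nat.reduceAdd] at l1 l2 l4 l5 b20 b44 b55
  fin_cases k
  · simp [psiCoeff, h0]
  · simp [psiCoeff]
    field_simp
    linear_combination l1 - l ^ Fintype.card K * hc
  · simp [psiCoeff]
    field_simp
    linear_combination l ^ Fintype.card K ^ 2 * b20 + ε * c * l2 + ε * l1
  · simp [psiCoeff, h3]
  · simp [psiCoeff]
    field_simp
    linear_combination l * b44 - 2 * b 4 * l4 - 2 * b 4 * c ^ Fintype.card K ^ 4 * l5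
  · simp [psiCoeff]
    field_simp
    linear_combination l * b55 - 2 * b 5 * l5
end

/-! ### Scatteredness, for an abstract endomorphism `F` in place of Frobenius. -/

section
variable {L : Type*} [Field L]

/-- The scattered property of `x ↦ ½(F x + F² x - F⁴ x + F⁵ x)`, in terms of the decompositions of
the vectors and of the slope into eigenvectors of `F³`. -/
theorem scattered_of_eigenvectors (F : L →+* L) (h2 : (2 : L) ≠ 0)
    (hneg : ∀ t : L, t * t = -1 → F t = t) {a b a' b' s t : L}
    (ha : F (F (F a)) = a) (hb : F (F (F b)) = -b) (ha' : F (F (F a')) = a')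
    (hb' : F (F (F b')) = -b') (hs : F (F (F s)) = s) (ht : F (F (F t)) = -t)
    (e1 : F (F a) = s * a + t * b) (e2 : F b = s * b + t * a)
    (e1' : F (F a') = s * a' + t * b') (e2' : F b' = s * b' + t * a') (h0 : a + b ≠ 0) :
    F (a + b) * (a' + b') = (a + b) * F (a' + b') := by
  have inj : ∀ z : L, F z = 0 → z = 0 := fun z hz => (map_eq_zero F).1 hz
  have self_neg : ∀ z : L, z = -z → z = 0 := fun z hz => by
    have : 2 * z = 0 := by linear_combination hz
    exact (mul_eq_zero.1 this).resolve_left h2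
  by_cases ht0 : t = 0
  · subst ht0
    simp only [zero_mul, add_zero] at e1 e2 e1' e2'
    -- A nonzero `u` makes `s * F s * F (F s)` equal to `1`, a nonzero `v` makes it `-1`. So for `t
    -- = 0` both vectors lie in one common eigenspace of `F³`.
    have excl : ∀ u v : L, F (F (F u)) = u → F (F (F v)) = -v → F (F u) = s * u → F v = s * v →
        u = 0 ∨ v = 0 := by
      intro u v hu hv eu ev
      by_contra! h
      have n1 : s * F s * F (F s) = 1 := by
        have f1 : u = F s * F u := by rw [← map_mul, ← eu, hu]
        have f2 : F u = F (F s) * F (F u) := (congrArg F f1).trans (map_mul F _ _)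
        have : u * (s * F s * F (F s)) = u := by
          rw [eu] at f2
          calc _ = F s * (F (F s) * (s * u)) := by ring
            _ = u := by rw [← f2, ← f1]
        exact mul_left_cancel₀ h.1 (this.trans (mul_one u).symm)
      have n2 : s * F s * F (F s) = -1 := by
        have : v * (s * F s * F (F s)) = v * (-1) := by
          have f1 : F (F v) = F s * F v := by rw [← map_mul, ← ev]
          have f2 : F (F (F v)) = F (F s) * F (F v) := by rw [f1, map_mul, f1]
          rw [hv, f1, ev] at f2
          linear_combination -f2
        exact mul_left_cancel₀ h.2 this
      have := n1.symm.trans n2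
      exact one_ne_zero (self_neg _ this)
    by_cases ha0 : a = 0
    · have hb0 : b ≠ 0 := by simpa [ha0] using h0
      have := (excl a' b ha' hb e1' e2).resolve_right hb0
      subst this; subst ha0
      simp only [zero_add]
      rw [e2, e2']; ring
    · have q1 := (excl a b ha hb e1 e2).resolve_left ha0
      have q2 := (excl a b' ha hb' e1 e2').resolve_left ha0
      subst q1; subst q2
      simp only [add_zero]
      have : F (F (F a) * a') = F (a * F (F a')) := congrArg F (by rw [e1, e1']; ring)
      rw [map_mul, map_mul, ha, ha'] at this
      exact this.symm
  have hb_eq : ∀ {u v}, F (F u) = s * u + t * v → v = (F (F u) - s * u) / t := by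
    intro u v h
    rw [eq_div_iff ht0]; linear_combination -h
  -- For `t ≠ 0` the component `a` determines `b`. If this determinant vanishes, `a' / a` is fixed
  -- by `F` and the vectors are proportional; otherwise a contradiction is derived.
  by_cases hδ : a * F a' - F a * a' = 0
  · have ha0 : a ≠ 0 := by
      rintro rfl
      simp only [map_zero, mul_zero, zero_add] at e1 h0
      exact mul_ne_zero ht0 h0 e1.symm
    obtain ⟨k, rfl⟩ : ∃ k, a' = k * a := ⟨a' / a, by field_simp⟩
    have hFa : F a ≠ 0 := fun h => ha0 (inj _ h)
    have hk : F k = k := by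
      have : a * F a * (F k - k) = 0 := by rw [← hδ, map_mul]; ring
      exact sub_eq_zero.1 ((mul_eq_zero.1 this).resolve_left (mul_ne_zero ha0 hFa))
    have : b' = k * b := by
      rw [hb_eq e1', hb_eq e1]; simp only [map_mul, hk]; ring
    subst this
    simp only [map_add, map_mul, hk]; ring
  exfalso
  -- Eliminating `v` leaves a second-order equation in `F` for `u` alone; `star` is its Wronskian
  -- (Casoratian) identity for the solutions `a` and `a'`.
  have E : ∀ {u v}, F (F (F u)) = u → F (F u) = s * u + t * v → F v = s * v + t * u →
      (t + F t * s ^ 2 - t ^ 2 * F t) * u - t * F s * F u - F t * s * F (F u) = 0 := by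
    intro u v hu e e'
    have f1 := congrArg F e
    simp only [map_add, map_mul, hu] at f1
    rw [e'] at f1
    linear_combination t * f1 - F t * s * e
  have E1 := E ha e1 e2
  have E2 := E ha' e1' e2'
  have star : t * F s * (a * F a' - F a * a') = F t * s * (F (F a) * a' - a * F (F a')) := by
    linear_combination a' * E1 - a * E2
  have s0 : s = 0 := by
    have star1 := congrArg F star
    have star2 := congrArg F star1
    simp only [map_sub, map_mul, ha, ha', ht, hs] at star1 star2
    by_contra hs0
    have hδ1 : F a * F (F a') - F (F a) * F a' ≠ 0 := fun h => hδ (inj _ (by simpa using h))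
    have hδ2 : F (F a) * a' - a * F (F a') ≠ 0 := fun h => hδ1 (inj _ (by simpa [ha, ha'] using h))
    have hP : (t * F t * F (F t)) * (s * F s * F (F s)) * ((a * F a' - F a * a') *
        (F a * F (F a') - F (F a) * F a') * (F (F a) * a' - a * F (F a'))) ≠ 0 := by
      have ht1 : F t ≠ 0 := fun h => ht0 (inj _ h)
      have ht2 : F (F t) ≠ 0 := fun h => ht1 (inj _ h)
      have hs1 : F s ≠ 0 := fun h => hs0 (inj _ h)
      have hs2 : F (F s) ≠ 0 := fun h => hs1 (inj _ h)
      exact mul_ne_zero (mul_ne_zero (mul_ne_zero (mul_ne_zero ht0 ht1) ht2)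
        (mul_ne_zero (mul_ne_zero hs0 hs1) hs2)) (mul_ne_zero (mul_ne_zero hδ hδ1) hδ2)
    apply hP
    apply self_neg
    -- The product of `star` and its two conjugates has the same factors on both sides, except that
    -- `F³ t = -t` contributes a sign.
    calc _ = (t * F s * (a * F a' - F a * a')) *
          (F t * F (F s) * (F a * F (F a') - F (F a) * F a')) *
          (F (F t) * s * (F (F a) * a' - a * F (F a'))) := by ring
      _ = _ := by rw [star, star1, star2]; ring
  subst s0
  have ha0 : a ≠ 0 := by rintro rfl; simp at hδ
  -- With `s = 0` this leads to `t * t = -1`. Then `hneg` gives `F t = t`, contradicting `F³ t = -t`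
  -- with `t ≠ 0`.
  have t1 : t * F t = 1 := by
    have : t * a * (1 - t * F t) = 0 := by
      rw [map_zero] at E1; linear_combination E1
    exact (sub_eq_zero.1 ((mul_eq_zero.1 this).resolve_left (mul_ne_zero ht0 ha0))).symm
  have t2 : F t * F (F t) = 1 := by rw [← map_mul, t1, map_one]
  have t3 : F (F t) * F (F (F t)) = 1 := by rw [← map_mul, t2, map_one]
  rw [ht] at t3
  have t4 : F (F t) = t := by linear_combination -F (F t) * t1 + t * t2
  rw [t4] at t3
  have t5 := hneg t (by linear_combination -t3)
  rw [t5] at ht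
  rw [t5, t5] at ht
  exact ht0 (self_neg t ht)

/-- `F³` is an involution, so `x`, `y` and `m` split as `(z ± F³ z) / 2`. Half the sum and half the
difference of the equation and its `F³`-image are its two eigencomponents. -/
theorem scattered_of_ringHom (F : L →+* L) (h2 : (2 : L) ≠ 0)
    (hF : ∀ z, F (F (F (F (F (F z))))) = z) (hneg : ∀ t : L, t * t = -1 → F t = t) {x y m : L}
    (hx : x ≠ 0)
    (ex : F x + F (F x) - F (F (F (F x))) + F (F (F (F (F x)))) = 2 * (m * x))
    (ey : F y + F (F y) - F (F (F (F y))) + F (F (F (F (F y)))) = 2 * (m * y)) :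
    F x * y = x * F y := by
  have key : ∀ z, F z + F (F z) - F (F (F (F z))) + F (F (F (F (F z)))) = 2 * (m * z) →
      F (F ((z + F (F (F z))) / 2)) = (m + F (F (F m))) / 2 * ((z + F (F (F z))) / 2) +
        (m - F (F (F m))) / 2 * ((z - F (F (F z))) / 2) ∧
      F ((z - F (F (F z))) / 2) = (m + F (F (F m))) / 2 * ((z - F (F (F z))) / 2) +
        (m - F (F (F m))) / 2 * ((z + F (F (F z))) / 2) := by
    intro z e
    have e3 := congrArg (fun w => F (F (F w))) e
    simp only [map_add, map_sub, map_mul, hF, map_ofNat] at e3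
    simp only [map_add, map_sub, map_div₀, map_ofNat]
    constructor <;> field_simp
    · linear_combination e + e3
    · linear_combination e - e3
  have plus : ∀ z, F (F (F ((z + F (F (F z))) / 2))) = (z + F (F (F z))) / 2 := fun z => by
    simp only [map_add, map_div₀, map_ofNat, hF]; ring
  have minus : ∀ z, F (F (F ((z - F (F (F z))) / 2))) = -((z - F (F (F z))) / 2) := fun z => by
    simp only [map_sub, map_div₀, map_ofNat, hF]; ring
  have dec : ∀ z, (z + F (F (F z))) / 2 + (z - F (F (F z))) / 2 = z := fun z => by
    field_simp; ring
  have := scattered_of_eigenvectors F h2 hneg (plus x) (minus x) (plus y) (minus y) (plus m)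
    (minus m) (key x ex).1 (key x ex).2 (key y ey).1 (key y ey).2 (by rwa [dec])
  simpa only [dec] using this
end

theorem pow_eq_self_of_sq_eq_neg_one {L : Type*} [Field L] {q : ℕ} (hq : q ≡ 1 [MOD 4]) {t : L}
    (ht : t * t = -1) : t ^ q = t := by
  have h : q = 4 * (q / 4) + 1 := by
    unfold Nat.ModEq at hq; omega
  have h4 : t ^ 4 = 1 := by
    calc t ^ 4 = (t * t) * (t * t) := by ring
      _ = 1 := by rw [ht]; ring
  rw [h, pow_succ, pow_mul, h4, one_pow, one_mul]

/-! ### `ψ_6` itself: scatteredness, inverse and trace adjoint. -/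

section
variable {K L : Type*} [Field K] [Fintype K] [Field L] [Algebra K L]

/-- The image of `K` already supplies all `q` possible roots of `X ^ q - X`. -/
theorem mem_range_algebraMap_of_pow_card_eq {z : L} (hz : z ^ Fintype.card K = z) :
    ∃ k : K, algebraMap K L k = z := by
  classical
  by_contra! h
  have h1 : 1 < Fintype.card K := Fintype.one_lt_card
  have hne := FiniteField.X_pow_card_sub_X_ne_zero L h1
  have := Polynomial.card_le_degree_of_subset_roots
    (p := (Polynomial.X ^ Fintype.card K - Polynomial.X : Polynomial L))
    (Z := insert z (univ.image (algebraMap K L))) (fun w hw => by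
      rw [Finset.mem_val, mem_insert, mem_image] at hw
      rw [Polynomial.mem_roots hne]
      rcases hw with rfl | ⟨k, -, rfl⟩
      · simp [hz]
      · simp [← map_pow, FiniteField.pow_card])
  rw [FiniteField.X_pow_card_sub_X_natDegree_eq L h1, card_insert_of_notMem (by simpa using h),
    card_image_of_injective _ (algebraMap K L).injective, card_univ] at this
  omega

/-- `ψ_6` is scattered. -/
theorem exists_smul_eq_of_psiMap_eq [Finite L] (hL : Module.finrank K L = 6)
    (hq : Fintype.card K ≡ 1 [MOD 4]) {x y m : L} (hx : x ≠ 0) (ex : psiMap K L 3 x = m * x)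
    (ey : psiMap K L 3 y = m * y) : ∃ k : K, y = k • x := by
  have h2 := two_ne_zero_of_card K L hq
  let F : L →+* L := (FiniteField.frobeniusAlgHom K L : L →+* L)
  have hF : ∀ z, F z = z ^ Fintype.card K := fun z => rfl
  have key : ∀ z, psiMap K L 3 z = m * z →
      F z + F (F z) - F (F (F (F z))) + F (F (F (F (F z)))) = 2 * (m * z) := by
    intro z hz
    rw [← hz, psiMap_three_apply, mul_div_cancel₀ _ h2]
    simp only [hF, ← pow_mul]
    ring
  have := scattered_of_ringHom F h2 (fun z => by
    have h := (pow_card_pow_mod hL z 6).symm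
    simp only [Nat.mod_self, pow_zero, pow_one] at h
    simp only [hF, ← pow_mul]
    conv_rhs => rw [← h]
    ring) (fun t ht => pow_eq_self_of_sq_eq_neg_one hq ht) hx (key x ex) (key y ey)
  have hFx : x ^ Fintype.card K ≠ 0 := pow_ne_zero _ hx
  obtain ⟨k, hk⟩ := mem_range_algebraMap_of_pow_card_eq (K := K) (z := y / x) (by
    rw [div_pow, div_eq_div_iff hFx hx]
    simp only [hF] at this
    linear_combination -this)
  exact ⟨k, by rw [Algebra.smul_def, hk, div_mul_cancel₀ _ hx]⟩

variable (K L) in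
/-- The inverse of `ψ_6`, which is also its adjoint with respect to the trace form. -/
def psiInvMap : L →ₗ[K] L :=
  (2⁻¹ : L) • (qPow K L 1 - qPow K L 2 + qPow K L 4 + qPow K L 5)

theorem psiInvMap_apply (x : L) : psiInvMap K L x =
    (x ^ Fintype.card K - x ^ (Fintype.card K ^ 2)
      + x ^ (Fintype.card K ^ 4) + x ^ (Fintype.card K ^ 5)) / 2 := by
  simp [psiInvMap, qPow_apply]
  ring

theorem psiMap_eq_sum (x : L) : psiMap K L 3 x =
    ∑ k, psiCoeff 1 k * x ^ Fintype.card K ^ (k : ℕ) := by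
  rw [psiMap_three_apply, Fin.sum_univ_six]
  simp [psiCoeff]
  ring

theorem psiInvMap_eq_sum (x : L) : psiInvMap K L x =
    ∑ k, psiCoeff (-1) k * x ^ Fintype.card K ^ (k : ℕ) := by
  rw [psiInvMap_apply, Fin.sum_univ_six]
  simp [psiCoeff]
  ring

theorem psiInvMap_psiMap [Finite L] (hL : Module.finrank K L = 6)
    (hq : Fintype.card K ≡ 1 [MOD 4]) (x : L) : psiInvMap K L (psiMap K L 3 x) = x := by
  have h2 := two_ne_zero_of_card K L hq
  have hP : ∀ i, (psiMap K L 3 x) ^ Fintype.card K ^ i =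
      (x ^ Fintype.card K ^ (i + 1) + x ^ Fintype.card K ^ (i + 2) - x ^ Fintype.card K ^ (i + 4)
        + x ^ Fintype.card K ^ (i + 5)) / 2 := by
    intro i
    rw [psiMap_three_apply, div_pow]
    have : (2 : L) ^ Fintype.card K ^ i = 2 := by
      simpa only [map_ofNat] using algebraMap_pow_card_pow (L := L) K 2 i
    rw [this, ← qPow_apply]
    simp only [map_add, map_sub, qPow_apply, ← pow_mul, ← pow_add, ← pow_succ', add_comm i]
  have hm : ∀ j, x ^ Fintype.card K ^ (j + 6) = x ^ Fintype.card K ^ j := fun j => by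
    rw [← pow_card_pow_mod hL x (j + 6), Nat.add_mod_right, pow_card_pow_mod hL]
  have hP1 := hP 1
  rw [pow_one] at hP1
  rw [psiInvMap_apply, hP1, hP, hP, hP]
  have h6 := hm 0
  have h7 := hm 1
  have h8 := hm 2
  have h9 := hm 3
  have h10 := hm 4
  simp only [Nat.reduceAdd, pow_zero, pow_one] at *
  rw [h6, h7, h8, h9, h10]
  field_simp
  ring

theorem trace_pow_card_pow [Finite L] (hL : Module.finrank K L = 6) (x : L) (i : ℕ) :
    Algebra.trace K L (x ^ Fintype.card K ^ i) = Algebra.trace K L x := by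
  have hfin : FiniteDimensional K L := Module.finite_of_finrank_pos (by omega)
  have := Algebra.trace_eq_of_algEquiv (FiniteField.frobeniusAlgEquivOfAlgebraic K L ^ i) x
  rw [← this, AlgEquiv.coe_pow, FiniteField.coe_frobeniusAlgEquivOfAlgebraic_iterate]

/-- The trace is Frobenius-invariant, so the adjoint of the `i`-th Frobenius power is the `(6 -
i)`-th: exponents `1, 5` and `2, 4` are exchanged. -/
theorem trace_mul_psiMap [Finite L] (hL : Module.finrank K L = 6) (u v : L) :
    Algebra.trace K L (u * psiMap K L 3 v) = Algebra.trace K L (psiInvMap K L u * v) := by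
  have key : ∀ i, i ≤ 6 → ∀ u, Algebra.trace K L (u * v ^ Fintype.card K ^ i) =
      Algebra.trace K L (u ^ Fintype.card K ^ (6 - i) * v) := by
    intro i hi u
    rw [← trace_pow_card_pow hL (u ^ Fintype.card K ^ (6 - i) * v) i, mul_pow, ← pow_mul, ← pow_add,
      Nat.sub_add_cancel hi]
    have := pow_card_pow_mod hL u 6
    simp only [Nat.mod_self, pow_zero, pow_one] at this
    rw [← this]
  have k1 := key 1 (by norm_num) (2⁻¹ * u)
  have k2 := key 2 (by norm_num) (2⁻¹ * u)
  have k4 := key 4 (by norm_num) (2⁻¹ * u)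
  have k5 := key 5 (by norm_num) (2⁻¹ * u)
  have hhalf : ∀ i, (2⁻¹ : L) ^ Fintype.card K ^ i = 2⁻¹ := fun i => by
    simpa only [map_inv₀, map_ofNat] using algebraMap_pow_card_pow (L := L) K 2⁻¹ i
  simp only [mul_pow, hhalf, Nat.reduceSub, pow_one] at k1 k2 k4 k5
  have e1 : u * psiMap K L 3 v = 2⁻¹ * u * v ^ Fintype.card K + 2⁻¹ * u * v ^ Fintype.card K ^ 2
      - 2⁻¹ * u * v ^ Fintype.card K ^ 4 + 2⁻¹ * u * v ^ Fintype.card K ^ 5 := by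
    rw [psiMap_three_apply]; ring
  have e2 : psiInvMap K L u * v = 2⁻¹ * u ^ Fintype.card K ^ 5 * v
      + 2⁻¹ * u ^ Fintype.card K ^ 4 * v - 2⁻¹ * u ^ Fintype.card K ^ 2 * v
      + 2⁻¹ * u ^ Fintype.card K * v := by
    rw [psiInvMap_apply]; ring
  have hh : (2⁻¹ : L) ^ Fintype.card K = 2⁻¹ := by simpa using hhalf 1
  rw [e1, e2]
  simp only [map_add, map_sub, k1, k2, k4, k5, hh]

/-- If `m` were not a slope of `f`, then `f - m` would be surjective; but `u` is trace-orthogonal to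
its image, so `u = 0`. -/
theorem IsSlope.of_adjoint [Finite L] [FiniteDimensional K L] {f f' : L →ₗ[K] L}
    (h : ∀ u v, Algebra.trace K L (u * f v) = Algebra.trace K L (f' u * v)) {m : L}
    (hm : IsSlope f' m) : IsSlope f m := by
  obtain ⟨u, hu, hum⟩ := hm
  by_contra hf
  have hinj : Function.Injective (f - LinearMap.mulLeft K m) := by
    rw [injective_iff_map_eq_zero]
    intro x hx
    by_contra hx0
    exact hf ⟨x, hx0, by simpa [sub_eq_zero] using hx⟩
  have hsurj := LinearMap.injective_iff_surjective.1 hinj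
  refine hu ((traceForm_nondegenerate K L).1 u fun z => ?_)
  obtain ⟨v, rfl⟩ := hsurj z
  rw [Algebra.traceForm_apply, LinearMap.sub_apply, mul_sub, map_sub, h, hum,
    LinearMap.mulLeft_apply, sub_eq_zero]
  congr 1
  ring

theorem isSlope_psiInvMap_iff [Finite L] (hL : Module.finrank K L = 6) (m : L) :
    IsSlope (psiInvMap K L) m ↔ IsSlope (psiMap K L 3) m := by
  have hfin : FiniteDimensional K L := Module.finite_of_finrank_pos (by omega)
  refine ⟨IsSlope.of_adjoint (trace_mul_psiMap hL), IsSlope.of_adjoint fun u v => ?_⟩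
  rw [mul_comm, ← trace_mul_psiMap hL, mul_comm]
end

/-! ### Linear sets of graphs and `ΓL`-orbits. -/

section
variable {K L : Type*} [Field K] [Field L] [Algebra K L]

theorem mk_mem_linearSet_iff {U : Submodule K (L × L)} {v : L × L} (hv : v ≠ 0) :
    Projectivization.mk L v hv ∈ linearSet K L U ↔ ∃ c : L, c ≠ 0 ∧ c • v ∈ U := by
  constructor
  · rintro ⟨u, hu, huU, h⟩
    obtain ⟨c, hc⟩ := (Projectivization.mk_eq_mk_iff' L u v hu hv).1 h.symm
    refine ⟨c, ?_, hc ▸ huU⟩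
    rintro rfl
    exact hu (by rw [← hc, zero_smul])
  · rintro ⟨c, hc, h⟩
    refine ⟨c • v, smul_ne_zero hc hv, h, ?_⟩
    exact ((Projectivization.mk_eq_mk_iff' L _ _ _ _).2 ⟨c, rfl⟩).symm

theorem mk_mem_linearSet_graph_iff (f : L →ₗ[K] L) (m : L) (h : ((1 : L), m) ≠ 0) :
    Projectivization.mk L (1, m) h ∈ linearSet K L (graphSubspace K L f) ↔ IsSlope f m := by
  rw [mk_mem_linearSet_iff]
  refine exists_congr fun c => and_congr_right fun _ => ?_
  simp [graphSubspace, LinearMap.mem_graph_iff, mul_comm, eq_comm]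

theorem linearSet_graph_eq_iff {f g : L →ₗ[K] L} :
    linearSet K L (graphSubspace K L f) = linearSet K L (graphSubspace K L g) ↔
      ∀ m, IsSlope f m ↔ IsSlope g m := by
  constructor
  · intro h m
    have hm : ((1 : L), m) ≠ 0 := by simp
    rw [← mk_mem_linearSet_graph_iff f m hm, h, mk_mem_linearSet_graph_iff]
  · intro h
    have key : ∀ {f g : L →ₗ[K] L}, (∀ m, IsSlope f m → IsSlope g m) →
        linearSet K L (graphSubspace K L f) ⊆ linearSet K L (graphSubspace K L g) := by
      rintro f g h _ ⟨⟨x, y⟩, hu, huU, rfl⟩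
      obtain rfl : y = f x := huU
      have hx : x ≠ 0 := by rintro rfl; simp at hu
      have hm : ((1 : L), f x / x) ≠ 0 := by simp
      have e : Projectivization.mk L (x, f x) hu = Projectivization.mk L (1, f x / x) hm :=
        (Projectivization.mk_eq_mk_iff' L _ _ _ _).2 ⟨x, by simp [mul_div_cancel₀ _ hx]⟩
      rw [e, mk_mem_linearSet_graph_iff]
      exact h _ ⟨x, hx, by field_simp⟩
    exact (key fun m => (h m).1).antisymm (key fun m => (h m).2)

/-- A `K`-subspace of `L²` with the linear set of a scattered graph is a graph. -/
theorem exists_eq_graph_of_scattered [Finite L] {f : L →ₗ[K] L}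
    (hf : ∀ {x y m : L}, x ≠ 0 → f x = m * x → f y = m * y → ∃ k : K, y = k • x)
    {U : Submodule K (L × L)} (hU : linearSet K L U = linearSet K L (graphSubspace K L f)) :
    ∃ g : L →ₗ[K] L, U = graphSubspace K L g := by
  classical
  -- The point `⟨(0, 1)⟩` is not on the linear set of a graph.
  have hinj : ∀ u ∈ U, u.1 = 0 → u = 0 := by
    intro u hu hu1
    by_contra h0
    have : Projectivization.mk L u h0 ∈ linearSet K L (graphSubspace K L f) :=
      hU ▸ ⟨u, h0, hu, rfl⟩
    obtain ⟨c, hc, hcu⟩ := (mk_mem_linearSet_iff h0).1 this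
    have h2 : c * u.2 = f (c * u.1) := hcu
    rw [hu1, mul_zero, map_zero] at h2
    exact h0 (Prod.ext hu1 ((mul_eq_zero.1 h2).resolve_left hc))
  have hfst : Function.Injective (LinearMap.fst K L L ∘ₗ U.subtype) := by
    rw [injective_iff_map_eq_zero]
    exact fun u hu => Subtype.ext (hinj u u.2 hu)
  have hslope : ∀ m, ∃ (x : L) (u : U), IsSlope f m →
      x ≠ 0 ∧ f x = m * x ∧ u ≠ 0 ∧ (u : L × L).2 = m * (u : L × L).1 := by
    intro m
    by_cases hm : IsSlope f m
    · obtain ⟨x, hx, hxm⟩ := id hm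
      have h1m : ((1 : L), m) ≠ 0 := by simp
      have := (mk_mem_linearSet_graph_iff f m h1m).2 hm
      rw [← hU] at this
      obtain ⟨c, hc, hcU⟩ := (mk_mem_linearSet_iff h1m).1 this
      refine ⟨x, ⟨_, hcU⟩, fun _ => ⟨hx, hxm, ?_, ?_⟩⟩
      · intro h
        have := congrArg (fun w : U => (w : L × L).1) h
        simp [hc] at this
      · simp [mul_comm]
    · exact ⟨0, 0, fun h => absurd h hm⟩
  choose X V hXV using hslope
  have hk : ∀ x, ∃ k : K, (x = 0 → k = 0) ∧ (x ≠ 0 → x = k • X (f x / x)) := by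
    intro x
    by_cases hx : x = 0
    · exact ⟨0, fun _ => rfl, fun h => absurd hx h⟩
    · have hxm : f x = f x / x * x := by field_simp
      obtain ⟨h1, h2, -⟩ := hXV _ ⟨x, hx, hxm⟩
      obtain ⟨k, hk⟩ := hf h1 h2 hxm
      exact ⟨k, fun h => absurd h hx, fun _ => hk⟩
  choose k hk0 hk using hk
  -- `X m` and `V m` are vectors of the graph (by first coordinate) and of `U` on the same point;
  -- scatteredness makes `x` a `K`-multiple of `X (f x / x)`, and `T` copies this multiple to `U`.
  -- It need not be linear: only its injectivity, giving `|L| ≤ |U|`, is used. Setting `k 0 = 0`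
  -- avoids the junk slope `0 / 0`.
  let T : L → U := fun x => k x • V (f x / x)
  have hT0 : ∀ x, x ≠ 0 → T x ≠ 0 := by
    intro x hx
    have hxm : f x = f x / x * x := by field_simp
    refine smul_ne_zero (fun h => hx ?_) (hXV _ ⟨x, hx, hxm⟩).2.2.1
    rw [hk x hx, h, zero_smul]
  have hTslope : ∀ x, x ≠ 0 → (T x : L × L).2 = f x / x * (T x : L × L).1 := by
    intro x hx
    have hxm : f x = f x / x * x := by field_simp
    simp [T, (hXV _ ⟨x, hx, hxm⟩).2.2.2]
  have hT : Function.Injective T := by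
    intro x y hxy
    by_cases hx : x = 0
    · by_contra hne
      have hy : y ≠ 0 := fun h => hne (hx.trans h.symm)
      refine hT0 y hy ?_
      rw [← hxy]; simp [T, hk0 x hx]
    by_cases hy : y = 0
    · refine absurd ?_ (hT0 x hx)
      rw [hxy]; simp [T, hk0 y hy]
    have h1 := hTslope x hx
    have h2 := hTslope y hy
    have hne : (T x : L × L).1 ≠ 0 := fun h => hT0 x hx (Subtype.ext (hinj _ (T x).2 h))
    have hm : f x / x = f y / y := by
      rw [← hxy, h1] at h2
      exact mul_right_cancel₀ hne h2
    have hxm : f x = f x / x * x := by field_simp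
    have hkk : k x = k y := by
      have : k x • V (f x / x) = k y • V (f y / y) := hxy
      rw [← hm] at this
      exact smul_left_injective K (hXV _ ⟨x, hx, hxm⟩).2.2.1 this
    rw [hk x hx, hk y hy, hkk, hm]
  have hbij : Function.Bijective (LinearMap.fst K L L ∘ₗ U.subtype) :=
    hfst.bijective_of_nat_card_le (Nat.card_le_card_of_injective T hT)
  let e := LinearEquiv.ofBijective _ hbij
  refine ⟨LinearMap.snd K L L ∘ₗ U.subtype ∘ₗ e.symm.toLinearMap, ?_⟩
  have he : ∀ u : U, e u = (u : L × L).1 := fun u => rfl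
  ext ⟨x, y⟩
  simp only [graphSubspace, LinearMap.mem_graph_iff, LinearMap.comp_apply, LinearMap.snd_apply,
    Submodule.subtype_apply, LinearEquiv.coe_coe]
  constructor
  · intro h
    rw [show x = e ⟨(x, y), h⟩ from rfl, e.symm_apply_apply]
  · intro h
    have h1 : (e.symm x : L × L) = (x, y) := Prod.ext (by rw [← he, e.apply_symm_apply]) h.symm
    exact h1 ▸ (e.symm x).2

theorem graphSubspace_eq_smul {f g : L →ₗ[K] L} {l : L} (hl : l ≠ 0)
    (h : ∀ x, g x = l * f (l⁻¹ * x)) : graphSubspace K L g = l • graphSubspace K L f := by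
  ext ⟨x, y⟩
  rw [Submodule.mem_smul_pointwise_iff_exists]
  simp only [graphSubspace, LinearMap.mem_graph_iff]
  constructor
  · rintro rfl
    exact ⟨(l⁻¹ * x, f (l⁻¹ * x)), rfl, by simp [h, hl]⟩
  · rintro ⟨⟨a, b⟩, hb, hab⟩
    simp only [Prod.smul_mk, smul_eq_mul, Prod.mk.injEq] at hab hb
    obtain ⟨rfl, rfl⟩ := hab
    subst hb
    rw [h, inv_mul_cancel_left₀ hl]

theorem SameGammaLOrbit.symm {U W : Submodule K (L × L)} (h : SameGammaLOrbit K L U W) :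
    SameGammaLOrbit K L W U := by
  obtain ⟨σ, g, hg, hUW⟩ := h
  refine ⟨σ.symm, g.symm, fun c v => ?_, ?_⟩
  · rw [AddEquiv.symm_apply_eq, hg, σ.apply_symm_apply, g.apply_symm_apply]
  · rw [← hUW, ← Set.image_comp]
    simp

theorem SameGammaLOrbit.trans {U V W : Submodule K (L × L)} (h : SameGammaLOrbit K L U V)
    (h' : SameGammaLOrbit K L V W) : SameGammaLOrbit K L U W := by
  obtain ⟨σ, g, hg, hUV⟩ := h
  obtain ⟨σ', g', hg', hVW⟩ := h'
  refine ⟨σ.trans σ', g.trans g', fun c v => by simp [hg, hg'], ?_⟩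
  rw [← hVW, ← hUV, ← Set.image_comp]
  rfl

theorem sameGammaLOrbit_smul {c : L} (hc : c ≠ 0) (U : Submodule K (L × L)) :
    SameGammaLOrbit K L (c • U) U := by
  refine SameGammaLOrbit.symm ⟨RingEquiv.refl L,
    (LinearEquiv.smulOfNeZero L (L × L) c hc).toAddEquiv, fun a v => ?_, ?_⟩
  · simp
  · rw [Submodule.coe_pointwise_smul]
    rfl

theorem sameGammaLOrbit_graph_of_inverse {f g : L →ₗ[K] L} (hfg : Function.LeftInverse g f)
    (hgf : Function.RightInverse g f) :
    SameGammaLOrbit K L (graphSubspace K L f) (graphSubspace K L g) := by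
  refine ⟨RingEquiv.refl L, AddEquiv.prodComm, fun c v => rfl, ?_⟩
  ext ⟨x, y⟩
  simp only [Set.mem_image, SetLike.mem_coe, graphSubspace, LinearMap.mem_graph_iff, Prod.exists]
  constructor
  · rintro ⟨a, b, hb, hab⟩
    obtain ⟨rfl, rfl⟩ : b = x ∧ a = y := by simpa [Prod.ext_iff] using hab
    rw [hb, hfg]
  · rintro h
    exact ⟨y, x, by rw [h, hgf], rfl⟩
end

/-! ### Classification of the defining subspaces and the two classes. -/

section
variable {K L : Type*} [Field K] [Fintype K] [Field L] [Algebra K L]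

theorem linearSet_psiInvMap [Finite L] (hL : Module.finrank K L = 6) :
    linearSet K L (graphSubspace K L (psiInvMap K L)) =
      linearSet K L (graphSubspace K L (psiMap K L 3)) :=
  linearSet_graph_eq_iff.2 (isSlope_psiInvMap_iff hL)

theorem psiMap_psiInvMap [Finite L] (hL : Module.finrank K L = 6)
    (hq : Fintype.card K ≡ 1 [MOD 4]) (x : L) : psiMap K L 3 (psiInvMap K L x) = x := by
  have hfin : FiniteDimensional K L := Module.finite_of_finrank_pos (by omega)
  have h : psiInvMap K L * psiMap K L 3 = 1 := LinearMap.ext (psiInvMap_psiMap hL hq)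
  exact LinearMap.congr_fun (mul_eq_one_comm.1 h) x

/-- The coefficient of index `1` forces `c ^ q = c`; the one of index `2`, whose sign differs, then
gives `1 = -1`. -/
theorem graph_psiMap_ne_smul [Finite L] (hL : Module.finrank K L = 6)
    (hq : Fintype.card K ≡ 1 [MOD 4]) {c : L} (hc : c ≠ 0) :
    graphSubspace K L (psiMap K L 3) ≠ c • graphSubspace K L (psiInvMap K L) := by
  intro h
  have h2 := two_ne_zero_of_card K L hq
  have hmap : ∀ x, psiMap K L 3 x = c * psiInvMap K L (c⁻¹ * x) := by
    intro x
    have hx : (x, psiMap K L 3 x) ∈ graphSubspace K L (psiMap K L 3) := rfl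
    rw [h, Submodule.mem_smul_pointwise_iff_exists] at hx
    obtain ⟨⟨a, b⟩, hb, hab⟩ := hx
    simp only [Prod.smul_mk, smul_eq_mul, Prod.mk.injEq] at hab
    obtain ⟨rfl, hab⟩ := hab
    rw [inv_mul_cancel_left₀ hc, ← hab]
    exact congrArg (c * ·) hb
  have hcoeff := linearized_coeff_unique (K := K) hL (a := psiCoeff 1)
    (b := fun k => c * psiCoeff (-1) k * c⁻¹ ^ Fintype.card K ^ (k : ℕ)) fun x => by
      rw [← psiMap_eq_sum, hmap, psiInvMap_eq_sum, mul_sum]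
      exact sum_congr rfl fun k _ => by rw [mul_pow]; ring
  have e1 := congrFun hcoeff 1
  have e2 := congrFun hcoeff 2
  have hcq : ∀ i, c ^ Fintype.card K ^ i ≠ 0 := fun i => pow_ne_zero _ hc
  simp [psiCoeff] at e1 e2
  have hc1 : c ^ Fintype.card K = c := by
    have := hcq 1
    rw [pow_one] at this
    field_simp at e1
    exact e1
  have hc2 : c ^ Fintype.card K ^ 2 = c := by rw [pow_two, pow_mul, hc1, hc1]
  rw [hc2] at e2
  field_simp at e2
  exact h2 (by linear_combination e2)

theorem eq_smul_graph_of_linearSet_eq [Finite L] (hL : Module.finrank K L = 6)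
    (hq : Fintype.card K ≡ 1 [MOD 4]) {U : Submodule K (L × L)}
    (hU : linearSet K L U = linearSet K L (graphSubspace K L (psiMap K L 3))) :
    ∃ c : L, c ≠ 0 ∧ (U = c • graphSubspace K L (psiMap K L 3) ∨
      U = c • graphSubspace K L (psiInvMap K L)) := by
  have := Fintype.ofFinite L
  obtain ⟨g, rfl⟩ := exists_eq_graph_of_scattered (exists_smul_eq_of_psiMap_eq hL hq) hU
  obtain ⟨b, hb⟩ := exists_linearized_coeff hL g
  obtain ⟨r0, r3, r1, r2, r4, r5⟩ := coeff_relations hL hq psiMap_eq_sum hb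
    (linearSet_graph_eq_iff.1 hU.symm)
  obtain ⟨l, hl, ε, hε, hbl⟩ := exists_scalar_of_coeff_relations hL hq r0 r3 r1 r2 r4 r5
  have hg : ∀ x, g x = l * ∑ k, psiCoeff ε k * (l⁻¹ * x) ^ Fintype.card K ^ (k : ℕ) := by
    intro x
    rw [hb, mul_sum]
    exact sum_congr rfl fun k _ => by rw [hbl, mul_pow]; ring
  refine ⟨l, hl, ?_⟩
  rcases hε with rfl | rfl
  · exact Or.inl (graphSubspace_eq_smul hl fun x => by rw [hg, psiMap_eq_sum])
  · exact Or.inr (graphSubspace_eq_smul hl fun x => by rw [hg, psiInvMap_eq_sum])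

theorem hasZGammaLClass_psiMap [Finite L] (hL : Module.finrank K L = 6)
    (hq : Fintype.card K ≡ 1 [MOD 4]) :
    HasZGammaLClass K L (linearSet K L (graphSubspace K L (psiMap K L 3))) 2 := by
  constructor
  · refine ⟨![graphSubspace K L (psiMap K L 3), graphSubspace K L (psiInvMap K L)], ?_, ?_⟩
    · rw [Fin.forall_fin_two]
      exact ⟨rfl, linearSet_psiInvMap hL⟩
    · have h1 : ∀ c : L, c ≠ 0 →
          graphSubspace K L (psiInvMap K L) ≠ c • graphSubspace K L (psiMap K L 3) := by
        intro c hc h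
        refine graph_psiMap_ne_smul hL hq (inv_ne_zero hc) ?_
        rw [h, inv_smul_smul₀ hc]
      simp only [Fin.forall_fin_two]
      exact ⟨⟨fun h => absurd rfl h, fun _ c hc => graph_psiMap_ne_smul hL hq hc⟩,
        ⟨fun _ => h1, fun h => absurd rfl h⟩⟩
  · rintro m ⟨U, hU, hne⟩
    choose c hc hcU using fun i => eq_smul_graph_of_linearSet_eq hL hq (hU i)
    by_contra! hm
    classical
    -- Pigeonhole: among three or more subspaces, two are multiples of the same one of the two
    -- graphs.
    obtain ⟨i, j, hij, h⟩ := Fintype.exists_ne_map_eq_of_card_lt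
      (fun i : Fin m => decide (U i = c i • graphSubspace K L (psiMap K L 3))) (by simpa using hm)
    have key : ∀ W : Submodule K (L × L), U i = c i • W → U j = c j • W → False := by
      intro W hi hj
      refine hne i j hij (c i * (c j)⁻¹) (mul_ne_zero (hc i) (inv_ne_zero (hc j))) ?_
      rw [hi, hj, mul_smul, inv_smul_smul₀ (hc j)]
    rw [decide_eq_decide] at h
    by_cases hi : U i = c i • graphSubspace K L (psiMap K L 3)
    · exact key _ hi (h.1 hi)
    · exact key _ ((hcU i).resolve_left hi) ((hcU j).resolve_left fun hj => hi (h.2 hj))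

theorem isSimpleLinearSet_psiMap [Finite L] (hL : Module.finrank K L = 6)
    (hq : Fintype.card K ≡ 1 [MOD 4]) :
    IsSimpleLinearSet K L (linearSet K L (graphSubspace K L (psiMap K L 3))) := by
  refine ⟨⟨_, rfl⟩, ⟨fun _ => graphSubspace K L (psiMap K L 3), fun _ => rfl,
    fun i j hij => absurd (Subsingleton.elim i j) hij⟩, ?_⟩
  rintro m ⟨U, hU, hne⟩
  by_contra! hm
  have hG : ∀ i, SameGammaLOrbit K L (U i) (graphSubspace K L (psiMap K L 3)) := by
    intro i
    obtain ⟨c, hc, h | h⟩ := eq_smul_graph_of_linearSet_eq hL hq (hU i)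
    · exact h ▸ sameGammaLOrbit_smul hc _
    · exact h ▸ (sameGammaLOrbit_smul hc _).trans
        (sameGammaLOrbit_graph_of_inverse (psiMap_psiInvMap hL hq) (psiInvMap_psiMap hL hq))
  exact hne ⟨0, by omega⟩ ⟨1, hm⟩ (by simp) ((hG _).trans (hG _).symm)
end

theorem proposition4p3 (K L : Type*) [Field K] [Fintype K] [Field L] [Algebra K L]
    (hL : Module.finrank K L = 6) (hq : Fintype.card K ≡ 1 [MOD 4]) :
    HasZGammaLClass K L (linearSet K L (graphSubspace K L (psiMap K L 3))) 2 ∧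
      IsSimpleLinearSet K L (linearSet K L (graphSubspace K L (psiMap K L 3))) := by
  have hfin : FiniteDimensional K L := Module.finite_of_finrank_pos (by omega)
  have : Finite L := Module.finite_of_finite K
  exact ⟨hasZGammaLClass_psiMap hL hq, isSimpleLinearSet_psiMap hL hq⟩
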